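/- Let $n\ge 2$ be an integer. Let $G_{\mathbb{Z}/n\mathbb{Z}}$ be the unitary Cayley graph of the ring $\mathbb{Z}/n\mathbb{Z}$, that is, the simple graph with vertex set $\mathbb{Z}/n\mathbb{Z}$ in which $x$ and $y$ are adjacent if and only if $x-y$ is a unit of $\mathbb{Z}/n\mathbb{Z}$, and let $\overline{G}_{\mathbb{Z}/n\mathbb{Z}}$ be its complement (the simple graph on the same vertices in which two distinct vertices are adjacent if and only if they are not adjacent in $G_{\mathbb{Z}/n\mathbb{Z}}$). A finite $r$-regular graph, not necessarily connected, is called Ramanujan if every eigenvalue $\mu$ of its adjacency matrix with $\mu\ne r$ and $\mu\neq -r$ satisfies $|\mu|\le 2\sqrt{r-1}$; when there is no such eigenvalue (for instance when $r=0$) the condition holds vacuously. Then $\overline{G}_{\mathbb{Z}/n\mathbb{Z}}$ is Ramanujan if and only if $n$ is of one of the following forms: (a) $n=p^{\alpha}$ with $p$ a prime and $\alpha\ge 1$; (b) $n=2\cdot3\cdot5$, $2\cdot3$, $2\cdot3^2$, $2\cdot5$, $2^2\cdot3$, $2^3\cdot3$, $3\cdot5$, $3\cdot7$ or $5\cdot7$.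 -/

import Mathlib

/-- The unitary Cayley graph of a ring `R`: the Cayley graph of the additive group of `R` with respect
to the set of units of `R`. -/
def unitaryCayleyGraph (R : Type*) [CommRing R] : SimpleGraph R :=
  SimpleGraph.addCayley {u : R | IsUnit u}

/-- If `1 ≠ 0` in `R`, then `x` and `y` are adjacent if and only if `x - y` is a unit. -/
theorem unitaryCayleyGraph_adj {R : Type*} [CommRing R] [Nontrivial R] (x y : R) :
    (unitaryCayleyGraph R).Adj x y ↔ IsUnit (x - y) := by
  have key : IsUnit (y - x) ↔ IsUnit (x - y) := by
    rw [← neg_sub x y, IsUnit.neg_iff]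
  rw [unitaryCayleyGraph, SimpleGraph.addCayley_adj']
  simp only [Set.mem_ofPred_eq]
  constructor
  · rintro ⟨-, g, hg, h | h⟩
    · have : g = y - x := by rw [← h]; ring
      rwa [← key, ← this]
    · have : g = x - y := by rw [h]; ring
      rwa [← this]
  · intro h
    refine ⟨?_, x - y, h, Or.inr (by ring)⟩
    rintro rfl
    simp at h

open Classical in
/-- A finite graph is Ramanujan if it is regular, of degree `r` say, and every eigenvalue `μ` of its
adjacency matrix other than `r` and `-r` satisfies `|μ| ≤ 2 √(r - 1)`. -/
noncomputable def IsRamanujanGraph {V : Type*} [Fintype V] (G : SimpleGraph V) : Prop :=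
  ∃ r : ℕ, G.IsRegularOfDegree r ∧
    ∀ μ : ℝ, Module.End.HasEigenvalue (Matrix.toLin' (G.adjMatrix ℝ)) μ →
      μ ≠ (r : ℝ) → μ ≠ -(r : ℝ) → |μ| ≤ 2 * Real.sqrt ((r : ℝ) - 1)

section

open Finset

section Translation

variable {n : ℕ} [NeZero n]

open Classical in
theorem unitaryCayleyGraph_isRegularOfDegree (hn : 2 ≤ n) :
    (unitaryCayleyGraph (ZMod n)).IsRegularOfDegree n.totient := by
  have : Fact (1 < n) := ⟨hn⟩
  intro x
  rw [← ZMod.card_units_eq_totient, ← SimpleGraph.card_neighborFinset_eq_degree,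
    ← Finset.card_univ]
  symm
  refine Finset.card_bij (fun u _ ↦ x - (u : ZMod n)) ?_ ?_ ?_
  · intro u _
    simp [unitaryCayleyGraph_adj]
  · intro u _ v _ h
    exact Units.ext (by simpa using h)
  · intro y hy
    rw [SimpleGraph.mem_neighborFinset, unitaryCayleyGraph_adj] at hy
    exact ⟨hy.unit, Finset.mem_univ _, by simp⟩

open Classical in
theorem adjMatrix_compl_unitaryCayleyGraph_mulVec (hn : 2 ≤ n) (f : ZMod n → ℝ) (x : ZMod n) :
    ((unitaryCayleyGraph (ZMod n))ᶜ.adjMatrix ℝ).mulVec f x =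
      (∑ y, if IsUnit (x - y) then 0 else f y) - f x := by
  have : Fact (1 < n) := ⟨hn⟩
  rw [eq_sub_iff_add_eq]
  have h : ∀ y, (if IsUnit (x - y) then 0 else f y) =
      ((unitaryCayleyGraph (ZMod n))ᶜ.adjMatrix ℝ) x y * f y + if x = y then f y else 0 := by
    intro y
    simp only [SimpleGraph.adjMatrix_apply, SimpleGraph.compl_adj, unitaryCayleyGraph_adj]
    by_cases hxy : x = y
    · subst hxy; simp
    · by_cases hu : IsUnit (x - y) <;> simp [hxy, hu]
  simp_rw [h, Finset.sum_add_distrib]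
  simp [Matrix.mulVec, dotProduct]

open Classical in
/-- The Ramanujan property in terms of the eigenfunctions of the convolution with the indicator
function of the non-units. -/
theorem isRamanujanGraph_compl_unitaryCayleyGraph_iff (hn : 2 ≤ n) :
    IsRamanujanGraph (unitaryCayleyGraph (ZMod n))ᶜ ↔
      ∀ (μ : ℝ) (f : ZMod n → ℝ), f ≠ 0 →
        (∀ x, (∑ y, if IsUnit (x - y) then 0 else f y) = (μ + 1) * f x) →
        μ ≠ ((n - 1 - n.totient : ℕ) : ℝ) → μ ≠ -((n - 1 - n.totient : ℕ) : ℝ) →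
        |μ| ≤ 2 * Real.sqrt (((n - 1 - n.totient : ℕ) : ℝ) - 1) := by
  have hreg : (unitaryCayleyGraph (ZMod n))ᶜ.IsRegularOfDegree (n - 1 - n.totient) := by
    have h := (unitaryCayleyGraph_isRegularOfDegree hn).compl
    rw [ZMod.card] at h
    convert h
  have heig : ∀ μ : ℝ, Module.End.HasEigenvalue
      (Matrix.toLin' ((unitaryCayleyGraph (ZMod n))ᶜ.adjMatrix ℝ)) μ ↔
      ∃ f : ZMod n → ℝ, f ≠ 0 ∧
        ∀ x, (∑ y, if IsUnit (x - y) then 0 else f y) = (μ + 1) * f x := by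
    intro μ
    have key : ∀ f : ZMod n → ℝ,
        Matrix.toLin' ((unitaryCayleyGraph (ZMod n))ᶜ.adjMatrix ℝ) f = μ • f ↔
        ∀ x, (∑ y, if IsUnit (x - y) then 0 else f y) = (μ + 1) * f x := by
      intro f
      rw [Matrix.toLin'_apply, funext_iff]
      refine forall_congr' fun x ↦ ?_
      rw [adjMatrix_compl_unitaryCayleyGraph_mulVec hn, Pi.smul_apply, smul_eq_mul, add_mul,
        one_mul, sub_eq_iff_eq_add]
    constructor
    · intro h
      obtain ⟨f, hf⟩ := h.exists_hasEigenvector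
      exact ⟨f, hf.2, (key f).1 hf.apply_eq_smul⟩
    · rintro ⟨f, hf, h⟩
      exact Module.End.hasEigenvalue_of_hasEigenvector
        (Module.End.hasEigenvector_iff.2 ⟨Module.End.mem_eigenspace_iff.2 ((key f).2 h), hf⟩)
  constructor
  · rintro ⟨r, hr, h⟩ μ f hf hfμ
    have hrr : r = n - 1 - n.totient := by
      rw [← hr 0, ← hreg 0]
      congr!
    subst hrr
    refine h μ ?_
    convert (heig μ).2 ⟨f, hf, hfμ⟩
  · intro h
    refine ⟨n - 1 - n.totient, by convert hreg, fun μ hμ ↦ ?_⟩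
    obtain ⟨f, hf, hfμ⟩ := (heig μ).1 (by convert hμ)
    exact h μ f hf hfμ

end Translation

section Arithmetic

theorem eight_mul_mul_le_totient_sq {p : ℕ} (hp : 2 ≤ p) (k : ℕ) (hk : k ≠ 0)
    (h : ∀ q, q.Prime → q ∣ k → p < q) :
    8 * p * k ≤ k.totient ^ 2 + (6 + 8 * p) * k.totient := by
  induction k using Nat.strong_induction_on with
  | _ k ih =>
    have tot : ∀ {q : ℕ}, q.Prime → q ∣ k → ∃ Q k' x, 1 ≤ Q ∧ q = x + 1 ∧ k' ≠ 0 ∧ k' < k ∧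
        k' ∣ k ∧ ¬ q ∣ k' ∧ k = Q * q * k' ∧ k.totient = Q * x * k'.totient := by
      intro q hq hqk
      obtain ⟨e, k', hqk', hkk⟩ := Nat.exists_eq_pow_mul_and_not_dvd hk q hq.ne_one
      have he : e ≠ 0 := by
        rintro rfl
        exact hqk' (by simpa [hkk] using hqk)
      obtain ⟨e, rfl⟩ := Nat.exists_eq_succ_of_ne_zero he
      have hk' : k' ≠ 0 := by rintro rfl; simp at hqk'
      refine ⟨q ^ e, k', q - 1, Nat.pos_of_ne_zero (pow_ne_zero _ hq.ne_zero), ?_, hk', ?_, ?_,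
        hqk', by rw [hkk, pow_succ], ?_⟩
      · have := hq.pos; omega
      · rw [hkk]
        exact lt_mul_left (Nat.pos_of_ne_zero hk') (Nat.one_lt_pow (by simp) hq.one_lt)
      · rw [hkk]; exact dvd_mul_left _ _
      · rw [hkk, Nat.totient_mul (((Nat.Prime.coprime_iff_not_dvd hq).2 hqk').pow_left _),
          Nat.totient_prime_pow_succ hq]
    have single : ∀ {q : ℕ}, q.Prime → q ∣ k → ∀ Q x, 1 ≤ Q → q = x + 1 → k = Q * q →
        k.totient = Q * x → 8 * p * k ≤ k.totient ^ 2 + (6 + 8 * p) * k.totient := by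
      intro q hq hqk Q x hQ hqx hkq hkt
      have hpq := h q hq hqk
      rw [hkt, hkq, hqx]
      have hpx : p ≤ x := by omega
      obtain ⟨Q, rfl⟩ := Nat.exists_eq_add_of_le hQ
      obtain ⟨y, rfl⟩ := Nat.exists_eq_add_of_le hpx
      obtain ⟨p, rfl⟩ := Nat.exists_eq_add_of_le hp
      ring_nf
      nlinarith [Nat.zero_le (Q * p * y), Nat.zero_le (Q * p ^ 2), Nat.zero_le (Q ^ 2 * p * y), Nat.zero_le (Q * y)]
    by_cases h5 : ∃ q, q.Prime ∧ q ∣ k ∧ 5 ≤ q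
    · obtain ⟨q, hq, hqk, hq5⟩ := h5
      obtain ⟨Q, k', x, hQ, hqx, hk', hlt, hdvd, hndvd, hkq, hkt⟩ := tot hq hqk
      by_cases hk1 : k' = 1
      · subst hk1
        exact single hq hqk Q x hQ hqx (by simpa using hkq) (by simpa using hkt)
      · have ih' := ih k' hlt hk' fun q hq hqk ↦ h q hq (hqk.trans hdvd)
        have hpt : p ≤ k'.totient := by
          obtain ⟨r, hr, hrk⟩ := Nat.exists_prime_and_dvd hk1
          have h1 := h r hr (hrk.trans hdvd)
          have h2 := Nat.le_of_dvd (Nat.totient_pos.2 (Nat.pos_of_ne_zero hk'))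
            (Nat.totient_dvd_of_dvd hrk)
          rw [Nat.totient_prime hr] at h2
          omega
        have hpx : p ≤ x := by have := h q hq hqk; omega
        generalize k'.totient = t at *
        rw [hkt, hkq, hqx]
        have hx : 4 ≤ x := by omega
        have hstep : (x + 1) * t + 6 + 8 * p ≤ x ^ 2 * t := by
          nlinarith [Nat.mul_le_mul hx hx, Nat.mul_le_mul hpt hx, Nat.mul_le_mul hpx hx, mul_le_mul' hpt hpx]
        calc 8 * p * (Q * (x + 1) * k') = Q * (x + 1) * (8 * p * k') := by ring
          _ ≤ Q * (x + 1) * (t ^ 2 + (6 + 8 * p) * t) := by gcongr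
          _ = Q * t * ((x + 1) * t + 6 + 8 * p) + (6 + 8 * p) * (Q * x * t) := by ring
          _ ≤ Q * t * (x ^ 2 * t) + (6 + 8 * p) * (Q * x * t) := by gcongr
          _ = Q * (x * t) ^ 2 + (6 + 8 * p) * (Q * x * t) := by ring
          _ ≤ Q ^ 2 * (x * t) ^ 2 + (6 + 8 * p) * (Q * x * t) := by
            gcongr
            exact Nat.le_self_pow two_ne_zero Q
          _ = _ := by ring
    · push Not at h5
      by_cases hk1 : k = 1
      · subst hk1; simp; omega
      · obtain ⟨q, hq, hqk⟩ := Nat.exists_prime_and_dvd hk1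
        have h3 : ∀ r, r.Prime → r ∣ k → r = 3 := by
          intro r hr hrk
          have h1 := h r hr hrk
          have h2 := h5 r hr hrk
          interval_cases r <;> first | omega | (exfalso; revert hr; norm_num)
        obtain ⟨Q, k', x, hQ, hqx, hk', hlt, hdvd, hndvd, hkq, hkt⟩ := tot hq hqk
        have hk1' : k' = 1 := by
          by_contra hne
          obtain ⟨r, hr, hrk⟩ := Nat.exists_prime_and_dvd hne
          rw [h3 q hq hqk, ← h3 r hr (hrk.trans hdvd)] at hndvd
          exact hndvd hrk
        subst hk1'
        exact single hq hqk Q x hQ hqx (by simpa using hkq) (by simpa using hkt)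

set_option synthInstance.maxSize 1000 in
set_option synthInstance.maxHeartbeats 200000 in
/-- The numbers of the second family are the only numbers `n` up to `337` which are not prime
powers and pass the eigenvalue bound attached to their smallest prime factor `p`. -/
theorem mem_list_of_le : ∀ n < 338, ∀ p < 18, (2 ≤ n ∧ 2 ≤ p ∧ p ∣ n ∧
    (∀ d < p, 2 ≤ d → ¬ d ∣ n) ∧ ¬ n ∣ p ^ 9 ∧
    n.totient ^ 2 + (4 * p - 6) * (p - 1) * n.totient + 9 * (p - 1) ^ 2 ≤ 4 * n * (p - 1) ^ 2) →
    n ∈ [30, 6, 18, 10, 12, 24, 15, 21, 35] := by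
  decide +kernel

theorem form_of_le {n p m : ℕ} (hn : 2 ≤ n) (hp : p = n.minFac) (hm : n.totient = (p - 1) * m)
    (hle : m ^ 2 + (4 * p - 6) * m + 9 ≤ 4 * n) :
    (∃ p α : ℕ, p.Prime ∧ 1 ≤ α ∧ n = p ^ α) ∨
        (n = 2 * 3 * 5 ∨ n = 2 * 3 ∨ n = 2 * 3 ^ 2 ∨ n = 2 * 5 ∨ n = 2 ^ 2 * 3 ∨
          n = 2 ^ 3 * 3 ∨ n = 3 * 5 ∨ n = 3 * 7 ∨ n = 5 * 7) := by
  have hpp : p.Prime := hp ▸ Nat.minFac_prime (by omega)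
  have hp2 := hpp.two_le
  have hpn : p ∣ n := hp ▸ Nat.minFac_dvd n
  by_cases hpow : ∃ j, n ∣ p ^ j
  · obtain ⟨j, hj⟩ := hpow
    obtain ⟨i, -, hi⟩ := (Nat.dvd_prime_pow hpp).1 hj
    refine Or.inl ⟨p, i, hpp, ?_, hi⟩
    by_contra h0
    have : i = 0 := by omega
    subst this
    simp at hi
    omega
  push Not at hpow
  right
  obtain ⟨e, k, hpk, hkk⟩ := Nat.exists_eq_pow_mul_and_not_dvd (by omega : n ≠ 0) p hpp.ne_one
  have he : e ≠ 0 := by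
    rintro rfl
    exact hpk (by simpa [hkk] using hpn)
  obtain ⟨e, rfl⟩ := Nat.exists_eq_succ_of_ne_zero he
  have hk0 : k ≠ 0 := by rintro rfl; simp at hpk
  have hk1 : k ≠ 1 := by
    rintro rfl
    exact hpow (e + 1) (by simp [hkk])
  have hkn : k ∣ n := hkk ▸ dvd_mul_left _ _
  have hprimes : ∀ q, q.Prime → q ∣ k → p < q := by
    intro q hq hqk
    have h1 : p ≤ q := hp ▸ Nat.minFac_le_of_dvd hq.two_le (hqk.trans hkn)
    exact lt_of_le_of_ne h1 fun h ↦ hpk (h ▸ hqk)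
  have hpt : p ≤ k.totient := by
    obtain ⟨r, hr, hrk⟩ := Nat.exists_prime_and_dvd hk1
    have h1 := hprimes r hr hrk
    have h2 := Nat.le_of_dvd (Nat.totient_pos.2 (Nat.pos_of_ne_zero hk0))
      (Nat.totient_dvd_of_dvd hrk)
    rw [Nat.totient_prime hr] at h2
    omega
  have hbound := eight_mul_mul_le_totient_sq hp2 k hk0 hprimes
  have hmP : m = p ^ e * k.totient := by
    have h1 : n.totient = (p - 1) * (p ^ e * k.totient) := by
      rw [hkk, Nat.totient_mul (((Nat.Prime.coprime_iff_not_dvd hpp).2 hpk).pow_left _),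
        Nat.totient_prime_pow_succ hpp]
      ring
    rw [h1] at hm
    exact (Nat.eq_of_mul_eq_mul_left (by omega) hm).symm
  have hP : 1 ≤ p ^ e := Nat.pos_of_ne_zero (pow_ne_zero _ hpp.ne_zero)
  have hnP : n = p ^ e * p * k := by rw [hkk, pow_succ]
  have hlt : n < 338 ∧ p < 18 := by
    clear hkk
    generalize p ^ e = P at *
    generalize k.totient = t at *
    obtain ⟨c, hc⟩ := Nat.exists_eq_add_of_le (show 6 ≤ 4 * p by omega)
    have hc' : 4 * p - 6 = c := by omega
    rw [hc', hnP, hmP] at hle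
    have h1 : P * (2 * P * t ^ 2 + 2 * c * t) < P * (t ^ 2 + (6 + 8 * p) * t) := by
      have := Nat.mul_le_mul_left P hbound
      nlinarith
    have h2 := Nat.lt_of_mul_lt_mul_left h1
    have h3 : t * (2 * P * t + 2 * c) < t * (t + (6 + 8 * p)) := by linarith
    have h4 := Nat.lt_of_mul_lt_mul_left h3
    have h5 : 2 * (P * t) < t + 18 := by nlinarith
    have h6 : t ≤ P * t := Nat.le_mul_of_pos_left t hP
    have h7 : P * t ≤ 17 := by omega
    refine ⟨?_, by omega⟩
    have h8 : 8 * n ≤ P * t * (t + 6 + 8 * p) := by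
      have := Nat.mul_le_mul_left P hbound
      rw [hnP]
      linarith
    have h9 : P * t * (t + 6 + 8 * p) ≤ 17 * (17 + 6 + 8 * 17) := by
      gcongr <;> omega
    omega
  suffices h : n ∈ [30, 6, 18, 10, 12, 24, 15, 21, 35] by simpa using h
  refine mem_list_of_le n hlt.1 p hlt.2 ⟨hn, hp2, hpn, ?_, hpow 9, ?_⟩
  · intro d hd hd2 hdn
    have := hp ▸ Nat.minFac_le_of_dvd hd2 hdn
    omega
  · rw [hm]
    calc _ = (p - 1) ^ 2 * (m ^ 2 + (4 * p - 6) * m + 9) := by ring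
      _ ≤ (p - 1) ^ 2 * (4 * n) := by gcongr
      _ = _ := by ring

end Arithmetic

section Eigenfunction

@[to_additive]
theorem card_sum_comp_monoidHom {G H : Type*} [Group G] [Group H] [Fintype G] [Fintype H]
    (φ : G →* H) (hφ : Function.Surjective φ) (h : H → ℝ) :
    (Fintype.card H : ℝ) * ∑ g, h (φ g) = Fintype.card G * ∑ v, h v := by
  have key : ∀ v : H, ∑ g, h (φ g) = ∑ g, h (φ g * v) := by
    intro v
    obtain ⟨w, rfl⟩ := hφ v
    simp_rw [← map_mul]
    exact (Equiv.sum_comp (Equiv.mulRight w) fun g ↦ h (φ g)).symm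
  calc (Fintype.card H : ℝ) * ∑ g, h (φ g) = ∑ _v : H, ∑ g, h (φ g) := by simp
    _ = ∑ v : H, ∑ g, h (φ g * v) := Finset.sum_congr rfl fun v _ ↦ key v
    _ = ∑ g, ∑ v : H, h (φ g * v) := Finset.sum_comm
    _ = ∑ _g : G, ∑ v, h v :=
      Finset.sum_congr rfl fun g _ ↦ Equiv.sum_comp (Equiv.mulLeft (φ g)) h
    _ = _ := by simp

theorem sum_units_eq_sum_ite {R : Type*} [CommRing R] [Fintype R] [Fintype Rˣ]
    [DecidablePred (IsUnit : R → Prop)] (h : R → ℝ) :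
    ∑ u : Rˣ, h u = ∑ z, if IsUnit z then h z else 0 := by
  rw [← Finset.sum_filter]
  refine Finset.sum_bij (fun u _ ↦ (u : R)) (by simp) (fun u _ v _ h ↦ Units.ext h) ?_ (by simp)
  intro z hz
  exact ⟨(Finset.mem_filter.1 hz).2.unit, Finset.mem_univ _, rfl⟩

open Classical in
theorem sum_nonunit_comp_castHom {n p m : ℕ} [NeZero n] [NeZero p] (hp : p.Prime) (hpn : p ∣ n)
    (hm : n.totient = (p - 1) * m) (g : ZMod p → ℝ) (hg : ∑ c, g c = 0) (x : ZMod n) :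
    (∑ y, if IsUnit (x - y) then 0 else g (ZMod.castHom hpn (ZMod p) y)) =
      m * g (ZMod.castHom hpn (ZMod p) x) := by
  have : Fact p.Prime := ⟨hp⟩
  set π := ZMod.castHom hpn (ZMod p) with hπ
  have hall : ∑ y, g (π y) = 0 := by
    have h := card_sum_comp_addMonoidHom π.toAddMonoidHom
      (ZMod.castHom_surjective hpn) g
    rw [hg, mul_zero, ZMod.card] at h
    exact (mul_eq_zero.1 h).resolve_left (by exact_mod_cast hp.ne_zero)
  have hunits : ∑ z : ZMod n, (if IsUnit z then g (π (x - z)) else 0) = -(m * g (π x)) := by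
    rw [← sum_units_eq_sum_ite fun z ↦ g (π (x - z))]
    have h := card_sum_comp_monoidHom (ZMod.unitsMap hpn) (ZMod.unitsMap_surjective hpn)
      fun v ↦ g (π x - v)
    rw [sum_units_eq_sum_ite fun v ↦ g (π x - v), ZMod.card_units_eq_totient,
      ZMod.card_units_eq_totient, hm, Nat.totient_prime hp] at h
    have h0 : (∑ z : ZMod p, if IsUnit z then g (π x - z) else 0) = - g (π x) := by
      have h1 : ∀ z : ZMod p, (if IsUnit z then g (π x - z) else 0) =
          g (π x - z) - if z = 0 then g (π x - z) else 0 := by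
        intro z
        by_cases hz : z = 0 <;> simp [hz]
      simp_rw [h1, Finset.sum_sub_distrib]
      have h2 : ∑ z, g (π x - z) = 0 := (Equiv.sum_comp (Equiv.subLeft (π x)) g).trans hg
      rw [h2]
      simp
    have hp1 : ((p - 1 : ℕ) : ℝ) ≠ 0 := by
      have := hp.two_le
      exact_mod_cast (by omega : p - 1 ≠ 0)
    rw [h0] at h
    have h2 : ∑ u : (ZMod n)ˣ, g (π x - (ZMod.unitsMap hpn u : (ZMod p)ˣ)) = m * -g (π x) := by
      apply mul_left_cancel₀ hp1
      rw [h]; push_cast; ring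
    rw [← mul_neg, ← h2]
    refine Finset.sum_congr rfl fun u _ ↦ ?_
    rw [map_sub]
    rfl
  rw [← Equiv.sum_comp (Equiv.subLeft x)] at hall ⊢
  simp only [Equiv.subLeft_apply, sub_sub_cancel] at hall ⊢
  have h3 : ∀ z : ZMod n, (if IsUnit z then 0 else g (π (x - z))) =
      g (π (x - z)) - if IsUnit z then g (π (x - z)) else 0 := by
    intro z
    split_ifs <;> simp
  simp_rw [h3, Finset.sum_sub_distrib, hall, hunits]
  simp

theorem form_of_isRamanujanGraph {n : ℕ} [NeZero n] (hn : 2 ≤ n)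
    (hR : IsRamanujanGraph (unitaryCayleyGraph (ZMod n))ᶜ) :
    (∃ p α : ℕ, p.Prime ∧ 1 ≤ α ∧ n = p ^ α) ∨
        (n = 2 * 3 * 5 ∨ n = 2 * 3 ∨ n = 2 * 3 ^ 2 ∨ n = 2 * 5 ∨ n = 2 ^ 2 * 3 ∨
          n = 2 ^ 3 * 3 ∨ n = 3 * 5 ∨ n = 3 * 7 ∨ n = 5 * 7) := by
  obtain ⟨p, hpdef⟩ : ∃ p, p = n.minFac := ⟨_, rfl⟩
  have hp : p.Prime := hpdef ▸ Nat.minFac_prime (by omega)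
  have hpn : p ∣ n := hpdef ▸ Nat.minFac_dvd n
  have hp2 := hp.two_le
  obtain ⟨e, k, hpk, hkk⟩ := Nat.exists_eq_pow_mul_and_not_dvd (by omega : n ≠ 0) p hp.ne_one
  have he : e ≠ 0 := by
    rintro rfl
    exact hpk (by simpa [hkk] using hpn)
  by_cases hk1 : k = 1
  · exact Or.inl ⟨p, e, hp, by omega, by simp [hkk, hk1]⟩
  obtain ⟨e, rfl⟩ := Nat.exists_eq_succ_of_ne_zero he
  have hk0 : k ≠ 0 := by rintro rfl; simp at hpk
  obtain ⟨m, hmdef⟩ : ∃ m, m = p ^ e * k.totient := ⟨_, rfl⟩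
  have hm : n.totient = (p - 1) * m := by
    rw [hkk, Nat.totient_mul (((Nat.Prime.coprime_iff_not_dvd hp).2 hpk).pow_left _),
      Nat.totient_prime_pow_succ hp, hmdef]
    ring
  have hP : 0 < p ^ e := Nat.pos_of_ne_zero (pow_ne_zero _ hp.ne_zero)
  have hm1 : 1 ≤ m := by
    rw [hmdef]
    exact Nat.mul_pos hP (Nat.totient_pos.2 (Nat.pos_of_ne_zero hk0))
  have hmn : p * m < n := by
    calc p * m = p * p ^ e * k.totient := by rw [hmdef]; ring
      _ < p * p ^ e * k :=
        Nat.mul_lt_mul_of_pos_left (Nat.totient_lt k (by omega)) (Nat.mul_pos hp.pos hP)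
      _ = n := by rw [hkk, Nat.succ_eq_add_one]; ring
  have hmr : n.totient + m < n := by
    rw [hm]
    calc (p - 1) * m + m = (p - 1 + 1) * m := by ring
      _ = p * m := by congr 1; omega
      _ < n := hmn
  have : Fact p.Prime := ⟨hp⟩
  rw [isRamanujanGraph_compl_unitaryCayleyGraph_iff hn] at hR
  have hr : ((n - 1 - n.totient : ℕ) : ℝ) = n - 1 - (p - 1) * m := by
    rw [Nat.cast_sub (by omega), Nat.cast_sub (by omega), hm]
    push_cast [Nat.cast_sub (by omega : 1 ≤ p)]
    ring
  have hmr' : (m : ℝ) ≤ n - 1 - (p - 1) * m := by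
    rw [← hr]
    exact_mod_cast (by omega)
  have hm1' : (1 : ℝ) ≤ m := by exact_mod_cast hm1
  let g : ZMod p → ℝ := Pi.single 0 1 - Pi.single 1 1
  have hbound := hR (m - 1) (fun y ↦ g (ZMod.castHom hpn (ZMod p) y)) ?_ ?_ ?_ ?_
  · rw [hr, abs_of_nonneg (by linarith)] at hbound
    have hsq := mul_self_le_mul_self (by linarith) hbound
    have hs := Real.mul_self_sqrt (show 0 ≤ (n : ℝ) - 1 - (p - 1) * m - 1 by linarith)
    refine form_of_le hn hpdef hm ?_
    have h6 : ((4 * p - 6 : ℕ) : ℝ) = 4 * p - 6 := by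
      rw [Nat.cast_sub (by omega)]; push_cast; ring
    have : (m : ℝ) ^ 2 + (4 * p - 6 : ℕ) * m + 9 ≤ 4 * n := by
      rw [h6]
      nlinarith
    exact_mod_cast this
  · intro h0
    have := congrFun h0 0
    simp [g] at this
  · intro x
    have hg : ∑ c, g c = 0 := by simp [g, Finset.sum_sub_distrib]
    simpa using sum_nonunit_comp_castHom hp hpn hm g hg x
  · rw [hr]; linarith
  · rw [hr]; linarith

end Eigenfunction

section Fourier

open scoped ZMod

variable {n : ℕ} [NeZero n]

/-- An eigenvalue of a convolution operator on `ZMod n` is a value of the Fourier transform of the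
kernel. -/
theorem exists_eq_sum_of_convolution_eq_mul (h f : ZMod n → ℂ) (hf : f ≠ 0) (c : ℂ)
    (hc : ∀ x, ∑ y, h (x - y) * f y = c * f x) :
    ∃ k, c = ∑ z, h z * ZMod.stdAddChar (z * k) := by
  have hF : 𝓕 f ≠ 0 := fun h0 ↦ hf ((ZMod.dft (N := n) (E := ℂ)).map_eq_zero_iff.1 h0)
  obtain ⟨k, hk⟩ := Function.ne_iff.1 hF
  refine ⟨-k, mul_right_cancel₀ hk ?_⟩
  rw [ZMod.dft_apply, Finset.mul_sum]
  calc ∑ x, c * (ZMod.stdAddChar (-(x * k)) • f x)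
      = ∑ x, ∑ y, ZMod.stdAddChar (-(x * k)) * (h (x - y) * f y) := by
        refine Finset.sum_congr rfl fun x _ ↦ ?_
        rw [← Finset.mul_sum, hc, smul_eq_mul]
        ring
    _ = ∑ y, ∑ x, ZMod.stdAddChar (-(x * k)) * (h (x - y) * f y) := Finset.sum_comm
    _ = ∑ y, ∑ z, ZMod.stdAddChar (-((z + y) * k)) * (h z * f y) := by
        refine Finset.sum_congr rfl fun y _ ↦ ?_
        rw [← Equiv.sum_comp (Equiv.addRight y)]
        simp
    _ = _ := by
        rw [Finset.mul_sum]
        refine Finset.sum_congr rfl fun y _ ↦ ?_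
        rw [Finset.sum_mul]
        refine Finset.sum_congr rfl fun z _ ↦ ?_
        rw [show -((z + y) * k) = z * -k + -(y * k) by ring, AddChar.map_add_eq_mul, smul_eq_mul]
        ring

theorem dvd_val_iff {D : ℕ} (hD : D ∣ n) (z : ZMod n) : D ∣ z.val ↔ (D : ZMod n) ∣ z := by
  constructor
  · rintro ⟨w, hw⟩
    exact ⟨w, by rw [← ZMod.natCast_zmod_val z, hw, Nat.cast_mul]⟩
  · rintro ⟨w, rfl⟩
    rw [← ZMod.natCast_zmod_val w, ← Nat.cast_mul, ZMod.val_natCast]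
    exact (Nat.dvd_mod_iff hD).2 (dvd_mul_right _ _)

theorem card_filter_dvd_val {D : ℕ} (hD : D ∣ n) :
    #{z : ZMod n | D ∣ z.val} = n / D := by
  obtain ⟨e, he⟩ := hD
  have hn := NeZero.ne n
  have hD0 : 0 < D := Nat.pos_of_ne_zero (by rintro rfl; simp at he; omega)
  rw [show n / D = e by rw [he, Nat.mul_div_cancel_left _ hD0], ← Finset.card_range e]
  symm
  have hval : ∀ w < e, ((D * w : ℕ) : ZMod n).val = D * w := by
    intro w hw
    rw [ZMod.val_natCast, Nat.mod_eq_of_lt]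
    rw [he]
    exact Nat.mul_lt_mul_of_pos_left hw hD0
  refine Finset.card_bij (fun w _ ↦ ((D * w : ℕ) : ZMod n)) ?_ ?_ ?_
  · intro w hw
    rw [Finset.mem_filter, hval w (Finset.mem_range.1 hw)]
    simp
  · intro w hw v hv h
    have := congrArg ZMod.val h
    rw [hval w (Finset.mem_range.1 hw), hval v (Finset.mem_range.1 hv)] at this
    exact Nat.eq_of_mul_eq_mul_left hD0 this
  · intro z hz
    obtain ⟨w, hw⟩ := (Finset.mem_filter.1 hz).2
    refine ⟨w, Finset.mem_range.2 ?_, by rw [← hw, ZMod.natCast_zmod_val]⟩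
    have := z.val_lt
    rw [hw] at this
    exact Nat.lt_of_mul_lt_mul_left (this.trans_eq he)

theorem sum_filter_dvd_stdAddChar {D : ℕ} (hD : D ∣ n) (k : ZMod n) :
    ∑ z : ZMod n with D ∣ z.val, ZMod.stdAddChar (z * k) =
      if n / D ∣ k.val then ((n / D : ℕ) : ℂ) else 0 := by
  have hn := NeZero.ne n
  have hD0 : 0 < D := Nat.pos_of_dvd_of_pos hD (Nat.pos_of_ne_zero hn)
  have hiff : n / D ∣ k.val ↔ (D : ZMod n) * k = 0 := by
    rw [← ZMod.natCast_zmod_val k, ← Nat.cast_mul, ZMod.natCast_eq_zero_iff, ZMod.natCast_zmod_val]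
    rw [← Nat.mul_dvd_mul_iff_left hD0, Nat.mul_div_cancel' hD]
  split_ifs with hk
  · rw [hiff] at hk
    rw [← card_filter_dvd_val hD, Finset.cast_card]
    refine Finset.sum_congr rfl fun z hz ↦ ?_
    obtain ⟨w, rfl⟩ := (dvd_val_iff hD z).1 (Finset.mem_filter.1 hz).2
    rw [mul_right_comm, hk, zero_mul, AddChar.map_zero_eq_one]
  · rw [hiff] at hk
    have hne : ZMod.stdAddChar ((D : ZMod n) * k) ≠ 1 := by
      rw [← AddChar.map_zero_eq_one (ZMod.stdAddChar (N := n))]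
      exact fun h ↦ hk (ZMod.injective_stdAddChar h)
    have hshift : ∑ z : ZMod n with D ∣ z.val, ZMod.stdAddChar (z * k) =
        ZMod.stdAddChar ((D : ZMod n) * k) *
          ∑ z : ZMod n with D ∣ z.val, ZMod.stdAddChar (z * k) := by
      rw [Finset.mul_sum, Finset.sum_filter, Finset.sum_filter,
        ← Equiv.sum_comp (Equiv.addRight (D : ZMod n))]
      refine Finset.sum_congr rfl fun z _ ↦ ?_
      simp only [Equiv.coe_addRight, dvd_val_iff hD, dvd_add_self_right]
      rw [add_mul, AddChar.map_add_eq_mul, mul_comm]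
    by_contra h0
    exact hne (mul_right_cancel₀ h0 (by rw [one_mul]; exact hshift.symm))

theorem isUnit_iff_forall_not_dvd_val (z : ZMod n) :
    IsUnit z ↔ ∀ p ∈ n.primeFactors, ¬ p ∣ z.val := by
  rw [← ZMod.natCast_zmod_val z, ZMod.isUnit_iff_coprime, ZMod.natCast_zmod_val]
  constructor
  · intro h p hp hpz
    have hp' := Nat.prime_of_mem_primeFactors hp
    exact hp'.one_lt.ne' (Nat.eq_one_of_dvd_coprimes h hpz (Nat.dvd_of_mem_primeFactors hp))
  · intro h
    refine Nat.coprime_of_dvd fun p hp hpz hpn ↦ ?_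
    exact h p (Nat.mem_primeFactors.2 ⟨hp, hpn, NeZero.ne n⟩) hpz

open Classical in
theorem ite_isUnit_eq_sum (z : ZMod n) :
    (if IsUnit z then (1 : ℂ) else 0) =
      ∑ T ∈ n.primeFactors.powerset, (-1) ^ #T * if (∏ p ∈ T, p) ∣ z.val then 1 else 0 := by
  have h1 : (if IsUnit z then (1 : ℂ) else 0) =
      ∏ p ∈ n.primeFactors, (1 - if p ∣ z.val then 1 else 0) := by
    split_ifs with h
    all_goals rw [isUnit_iff_forall_not_dvd_val] at h
    · exact (Finset.prod_eq_one fun p hp ↦ by simp [h p hp]).symm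
    · push Not at h
      obtain ⟨p, hp, hpz⟩ := h
      exact (Finset.prod_eq_zero hp (by simp [hpz])).symm
  rw [h1, Finset.prod_sub]
  refine Finset.sum_congr rfl fun T hT ↦ ?_
  rw [Finset.prod_const_one, mul_one]
  congr 1
  have hprime : ∀ p ∈ T, p.Prime := fun p hp ↦
    Nat.prime_of_mem_primeFactors (Finset.mem_powerset.1 hT hp)
  by_cases h : (∏ p ∈ T, p) ∣ z.val
  · rw [if_pos h]
    exact Finset.prod_eq_one fun p hp ↦ if_pos ((Finset.dvd_prod_of_mem _ hp).trans h)
  · rw [if_neg h]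
    have : ∃ p ∈ T, ¬ p ∣ z.val := by
      by_contra! hall
      exact h (Finset.prod_primes_dvd _ (fun p hp ↦ (hprime p hp).prime) hall)
    obtain ⟨p, hp, hpz⟩ := this
    exact Finset.prod_eq_zero hp (if_neg hpz)

/-- The Fourier coefficient at `k` of the indicator function of the non-units of `ZMod n`, where
`s` is the set of prime factors of `n`. -/
def nonunitCoeff (n : ℕ) (s : Finset ℕ) (k : ℕ) : ℤ :=
  (if n ∣ k then (n : ℤ) else 0) - ∑ T ∈ s.powerset,
    (-1) ^ #T * if n / (∏ p ∈ T, p) ∣ k then ((n / ∏ p ∈ T, p : ℕ) : ℤ) else 0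

open Classical in
theorem sum_nonunit_stdAddChar (k : ZMod n) :
    ∑ z : ZMod n, (if IsUnit z then 0 else 1) * ZMod.stdAddChar (z * k) =
      (nonunitCoeff n n.primeFactors k.val : ℂ) := by
  have hz : ∀ z : ZMod n, (if IsUnit z then (0 : ℂ) else 1) = 1 - if IsUnit z then 1 else 0 := by
    intro z; split_ifs <;> simp
  simp_rw [hz, ite_isUnit_eq_sum, sub_mul, Finset.sum_sub_distrib, one_mul, Finset.sum_mul]
  rw [Finset.sum_comm, nonunitCoeff, Int.cast_sub, Int.cast_sum]
  congr 1
  · simpa using sum_filter_dvd_stdAddChar (one_dvd n) k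
  · refine Finset.sum_congr rfl fun T hT ↦ ?_
    have hD : (∏ p ∈ T, p) ∣ n :=
      (Finset.prod_dvd_prod_of_subset _ _ _ (Finset.mem_powerset.1 hT)).trans
        (Nat.prod_primeFactors_dvd n)
    have := sum_filter_dvd_stdAddChar hD k
    rw [Finset.sum_filter] at this
    have hcast : ((if n / (∏ p ∈ T, p) ∣ k.val then ((n / ∏ p ∈ T, p : ℕ) : ℤ) else 0 : ℤ) : ℂ) =
        if n / (∏ p ∈ T, p) ∣ k.val then ((n / ∏ p ∈ T, p : ℕ) : ℂ) else 0 := by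
      split_ifs <;> simp only [Int.cast_natCast, Int.cast_zero]
    rw [Int.cast_mul, hcast, ← this, Finset.mul_sum, Int.cast_pow, Int.cast_neg, Int.cast_one]
    refine Finset.sum_congr rfl fun z _ ↦ ?_
    rw [mul_assoc, ite_mul, one_mul, zero_mul]

open Classical in
theorem exists_eq_nonunitCoeff (f : ZMod n → ℝ) (hf : f ≠ 0) (c : ℝ)
    (hc : ∀ x, (∑ y, if IsUnit (x - y) then 0 else f y) = c * f x) :
    ∃ k < n, c = nonunitCoeff n n.primeFactors k := by
  obtain ⟨k, hk⟩ := exists_eq_sum_of_convolution_eq_mul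
    (fun z : ZMod n ↦ if IsUnit z then 0 else 1) (fun x ↦ (f x : ℂ))
    (fun h ↦ hf (funext fun x ↦ by simpa using congrFun h x)) c (by
      intro x
      have := congrArg (fun t : ℝ ↦ (t : ℂ)) (hc x)
      push_cast at this
      rw [← this]
      refine Finset.sum_congr rfl fun y _ ↦ ?_
      split_ifs <;> simp)
  rw [sum_nonunit_stdAddChar] at hk
  exact ⟨k.val, k.val_lt, by exact_mod_cast hk⟩

/-- A criterion for the Ramanujan property which is decidable for each `n`. -/
theorem isRamanujanGraph_of_nonunitCoeff (hn : 2 ≤ n)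
    (h : ∀ k < n, nonunitCoeff n n.primeFactors k - 1 = (n - 1 - n.totient : ℕ) ∨
      nonunitCoeff n n.primeFactors k - 1 = -(n - 1 - n.totient : ℕ) ∨
      (nonunitCoeff n n.primeFactors k - 1) ^ 2 ≤ 4 * ((n - 1 - n.totient : ℕ) - 1)) :
    IsRamanujanGraph (unitaryCayleyGraph (ZMod n))ᶜ := by
  rw [isRamanujanGraph_compl_unitaryCayleyGraph_iff hn]
  intro μ f hf hfμ hμ hμ'
  obtain ⟨k, hk, hkμ⟩ := exists_eq_nonunitCoeff f hf _ hfμ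
  have hμk : μ = (nonunitCoeff n n.primeFactors k - 1 : ℤ) := by
    push_cast; linarith
  rw [hμk] at hμ hμ' ⊢
  rcases h k hk with h | h | h
  · exact absurd (by rw [h]; simp) hμ
  · exact absurd (by rw [h]; simp) hμ'
  · have h' : ((nonunitCoeff n n.primeFactors k - 1 : ℤ) : ℝ) ^ 2 ≤
        4 * (((n - 1 - n.totient : ℕ) : ℝ) - 1) := by exact_mod_cast h
    refine abs_le_of_sq_le_sq ?_ (by positivity)
    rw [mul_pow, Real.sq_sqrt (by nlinarith [sq_nonneg ((nonunitCoeff n n.primeFactors k - 1 : ℤ) : ℝ)])]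
    linarith

theorem isRamanujanGraph_prime_pow {p α : ℕ} (hp : p.Prime) (hα : 1 ≤ α) (hnp : n = p ^ α) :
    IsRamanujanGraph (unitaryCayleyGraph (ZMod n))ᶜ := by
  obtain ⟨e, rfl⟩ := Nat.exists_eq_add_of_le' hα
  have hp2 := hp.two_le
  have hP : 1 ≤ p ^ e := Nat.pos_of_ne_zero (pow_ne_zero _ hp.ne_zero)
  have hn : 2 ≤ n := by
    rw [hnp, pow_succ]
    exact hp2.trans (Nat.le_mul_of_pos_left p hP)
  have hdiv : n / p = p ^ e := by rw [hnp, pow_succ, Nat.mul_div_cancel _ hp.pos]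
  have hr : n - 1 - n.totient = p ^ e - 1 := by
    rw [hnp, Nat.totient_prime_pow_succ hp, pow_succ, Nat.mul_sub, mul_one]
    have : p ^ e ≤ p ^ e * p := Nat.le_mul_of_pos_right _ hp.pos
    omega
  refine isRamanujanGraph_of_nonunitCoeff hn fun k _ ↦ ?_
  have hpow : n.primeFactors.powerset = {∅, {p}} := by
    rw [hnp, Nat.primeFactors_prime_pow (by omega) hp]
    rfl
  have hcoeff : nonunitCoeff n n.primeFactors k = if p ^ e ∣ k then ((p ^ e : ℕ) : ℤ) else 0 := by
    rw [nonunitCoeff, hpow, Finset.sum_pair (by simp)]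
    by_cases hk : p ^ e ∣ k <;> simp [hdiv, hk]
  rw [hcoeff, hr]
  generalize p ^ e = P at *
  split_ifs with hk
  · left; omega
  · right
    have : P ≠ 1 := by rintro rfl; simp at hk
    by_cases h2 : P = 2
    · left; subst h2; norm_num
    · right; push_cast [Nat.cast_sub hP]; omega

theorem isRamanujanGraph_of_mem (hn : n ∈ [30, 6, 18, 10, 12, 24, 15, 21, 35]) :
    IsRamanujanGraph (unitaryCayleyGraph (ZMod n))ᶜ := by
  have key : ∀ l ∈ [(30, {2, 3, 5}), (6, {2, 3}), (18, {2, 3}), (10, {2, 5}), (12, {2, 3}),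
      (24, {2, 3}), (15, {3, 5}), (21, {3, 7}), (35, ({5, 7} : Finset ℕ))], ∀ k < l.1,
      nonunitCoeff l.1 l.2 k - 1 = (l.1 - 1 - l.1.totient : ℕ) ∨
      nonunitCoeff l.1 l.2 k - 1 = -(l.1 - 1 - l.1.totient : ℕ) ∨
      (nonunitCoeff l.1 l.2 k - 1) ^ 2 ≤ 4 * ((l.1 - 1 - l.1.totient : ℕ) - 1) := by
    decide +kernel
  have hpf : (n, n.primeFactors) ∈ [(30, {2, 3, 5}), (6, {2, 3}), (18, {2, 3}), (10, {2, 5}),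
      (12, {2, 3}), (24, {2, 3}), (15, {3, 5}), (21, {3, 7}), (35, ({5, 7} : Finset ℕ))] := by
    simp only [List.mem_cons, List.not_mem_nil, or_false] at hn
    rcases hn with rfl | rfl | rfl | rfl | rfl | rfl | rfl | rfl | rfl <;> decide +kernel
  refine isRamanujanGraph_of_nonunitCoeff ?_ (key _ hpf)
  simp only [List.mem_cons, List.not_mem_nil, or_false] at hn
  omega

end Fourier

end

theorem corollary4p3 (n : ℕ) [NeZero n] (hn : 2 ≤ n) :
    IsRamanujanGraph (unitaryCayleyGraph (ZMod n))ᶜ ↔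
      (∃ p α : ℕ, p.Prime ∧ 1 ≤ α ∧ n = p ^ α) ∨
        (n = 2 * 3 * 5 ∨ n = 2 * 3 ∨ n = 2 * 3 ^ 2 ∨ n = 2 * 5 ∨ n = 2 ^ 2 * 3 ∨
          n = 2 ^ 3 * 3 ∨ n = 3 * 5 ∨ n = 3 * 7 ∨ n = 5 * 7) := by
  refine ⟨form_of_isRamanujanGraph hn, ?_⟩
  rintro (⟨p, α, hp, hα, h⟩ | h)
  · exact isRamanujanGraph_prime_pow hp hα h
  · exact isRamanujanGraph_of_mem (by simpa using h)
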